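/- Let $M$ be a von Neumann algebra with a faithful normal state $\varphi$ (not assumed tracial), let $X=(x_1,\dots,x_n)\in M^n$ be a tuple of self-adjoint elements, and let $\mathcal P=\mathbb C\langle t_1,\dots,t_n\rangle$ be the algebra of noncommutative polynomials. Let $\partial_i:\mathcal P\to\mathcal P\otimes\mathcal P$ be the derivation with $\partial_i t_j=\delta_{ij}\,1\otimes 1$, let $\mathcal D_i V$ be the image of $\partial_i V$ under $P\otimes Q\mapsto QP$, and put $\mathcal DV=(\mathcal D_1V,\dots,\mathcal D_nV)$ and $\mathcal JP=(\partial_jP_i)_{i,j}$ for $P\in\mathcal P^n$. Evaluations at $X$ are written $P(X)\in M$ for $P\in\mathcal P$ and $Q(X)\in M\otimes M^{op}$ for $Q\in\mathcal P\otimes\mathcal P$. Write $\langle x,y\rangle_\varphi=\sum_i\varphi(x_iy_i^*)$ on $M^n$, and let $L^2$ be the Hilbert space $L^2\big(M_n(M\bar\otimes M^{op}),(\varphi\otimes\varphi^{op})\circ\mathrm{Tr}\big)$, the completion of $M_n(M\otimes M^{op})$ for $\langle A,B\rangle=\sum_{i,j}(\varphi\otimes\varphi^{op})(a_{ij}b_{ij}^*)$.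 On $M$ and on $M\otimes M^{op}$ put $\|a\|_2^2=\varphi(aa^*)$ and $\|a\|_2^2=(\varphi\otimes\varphi^{op})(aa^*)$ respectively, and $\|x\|_2^2=\langle x,x\rangle_\varphi$ for $x\in M^n$. A free Stein kernel for $X$ relative to $V\in\mathcal P$ is an $A\in L^2$ with $\langle[\mathcal DV](X),P(X)\rangle_\varphi=\langle A,[\mathcal JP](X)\rangle$ for all $P\in\mathcal P^n$. The free Stein discrepancy $\Sigma^*(X|V)$ is the infimum of $\|A-(1\otimes1^{op})\otimes I_n\|_{L^2}$ over all such $A$. Let $C_{opt}(X)$ be the least $C\ge 0$ such that $$\|P(X)-\varphi(P(X))\|_2^2\le C\sum_{i=1}^n\|\partial_iP(X)\|_2^2\qquad\text{for all }P\in\mathcal P.$$ Then a (finite) least constant $C_{opt}(X)$ exists, and the following hold. (1) For every $V\in\mathcal P$ with $\varphi([\mathcal D_iV](X))=0$ for $i=1,\dots,n$, there exists a free Stein kernel $A$ for $X$ relative to $V$ such that $$\Sigma^*(X|V)^2\le\|A-(1\otimes1^{op})\otimes I_n\|_{L^2}^2\le n+C_{opt}(X)\,\|[\mathcal DV](X)\|_2^2-2\,\mathrm{Re}\,\langle[\mathcal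 DV](X),X\rangle_\varphi .$$ (2) If $\varphi(x_i)=0$ for all $i$ and $\sum_{i=1}^n\varphi(x_i^2)=n$, then $$\Sigma^*\Big(X\,\Big|\,\tfrac12\sum_{i=1}^nt_i^2\Big)^2\le n\,(C_{opt}(X)-1).$$ -/

import Mathlib

open scoped TensorProduct ComplexOrder Matrix

set_option linter.unusedSectionVars false

noncomputable section

namespace FreeStein

/-! ## Positive functionals and their `L²` spaces -/

section Functional

variable {A : Type*} [Ring A] [StarRing A] [Algebra ℂ A] [StarModule ℂ A]

/-- A positive linear functional on a unital complex `*`-algebra. -/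
structure PositiveFunctional (A : Type*) [Ring A] [StarRing A] [Algebra ℂ A] where
  /-- The underlying linear form. -/
  toLinearMap : A →ₗ[ℂ] ℂ
  nonneg' : ∀ a : A, 0 ≤ toLinearMap (a * star a)

instance : CoeFun (PositiveFunctional A) (fun _ => A → ℂ) := ⟨fun ψ => ψ.toLinearMap⟩

namespace PositiveFunctional

variable (ψ : PositiveFunctional A)

theorem nonneg (a : A) : 0 ≤ ψ (a * star a) := ψ.nonneg' a

theorem star_mul_star (a b : A) : star (ψ (a * star b)) = ψ (b * star a) := by
  have im0 : ∀ c : A, (ψ (c * star c)).im = 0 := fun c => ((Complex.le_def.mp (ψ.nonneg c)).2).symm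
  have ha := im0 a
  have hb := im0 b
  have h1 := im0 (a + b)
  have h2 := im0 (a + Complex.I • b)
  simp only [star_add, add_mul, mul_add, map_add, star_smul, smul_mul_assoc, mul_smul_comm,
    map_smul, smul_eq_mul, Complex.add_im, Complex.mul_im, Complex.mul_re, Complex.star_def,
    Complex.conj_I, Complex.neg_re, Complex.neg_im, Complex.I_re, Complex.I_im] at h1 h2
  apply Complex.ext
  · simp only [Complex.star_def, Complex.conj_re]
    linarith
  · simp only [Complex.star_def, Complex.conj_im]
    linarith

/-- The space `A` with the semi-inner product `⟨a, b⟩ = ψ (a * b^*)`. -/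
def PreL2 (_ψ : PositiveFunctional A) : Type _ := A

instance : AddCommGroup ψ.PreL2 := inferInstanceAs (AddCommGroup A)

instance : Module ℂ ψ.PreL2 := inferInstanceAs (Module ℂ A)

/-- The identity map from `A` to the pre-Hilbert space `PreL2`. -/
def toPreL2 : A ≃ₗ[ℂ] ψ.PreL2 := LinearEquiv.refl ℂ _

/-- Mathlib's inner products are linear in the second variable, whence
`inner a b = ψ (b * a^*)`. -/
abbrev preL2Core : PreInnerProductSpace.Core ℂ ψ.PreL2 where
  inner a b := ψ (ψ.toPreL2.symm b * star (ψ.toPreL2.symm a))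
  conj_inner_symm a b := ψ.star_mul_star _ _
  re_inner_nonneg a := (Complex.le_def.mp (ψ.nonneg (ψ.toPreL2.symm a))).1
  add_left a b c := by simp [mul_add]
  smul_left a b r := by simp

instance : SeminormedAddCommGroup ψ.PreL2 :=
  InnerProductSpace.Core.toSeminormedAddCommGroup (c := ψ.preL2Core)

instance : InnerProductSpace ℂ ψ.PreL2 := InnerProductSpace.ofCore ψ.preL2Core

/-- The Hilbert space `L²(A, ψ)`: the completion of `A` for `⟨a, b⟩ = ψ (a * b^*)`. -/
abbrev L2 : Type _ := UniformSpace.Completion ψ.PreL2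

/-- The canonical map `A → L²(A, ψ)`. -/
def toL2 (a : A) : ψ.L2 := (ψ.toPreL2 a : ψ.L2)

theorem inner_toL2 (a b : A) : inner ℂ (ψ.toL2 a) (ψ.toL2 b) = ψ (b * star a) :=
  UniformSpace.Completion.inner_coe _ _

/-- The squared `L²` norm `‖a‖₂² = ψ (a * a^*)`. -/
def normSq (a : A) : ℝ := (ψ (a * star a)).re

theorem normSq_eq_norm_toL2_sq (a : A) : ψ.normSq a = ‖ψ.toL2 a‖ ^ 2 := by
  rw [← inner_self_eq_norm_sq (𝕜 := ℂ), inner_toL2]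
  rfl

/-- The functional `ψ^op` on the opposite algebra, given by the same values as `ψ`. -/
def op : PositiveFunctional Aᵐᵒᵖ where
  toLinearMap := ψ.toLinearMap ∘ₗ (MulOpposite.opLinearEquiv ℂ).symm.toLinearMap
  nonneg' a := by simpa using ψ.nonneg (star a.unop)

@[simp] theorem op_apply (a : A) : ψ.op (MulOpposite.op a) = ψ a := rfl

section Tensor

variable {B : Type*} [Ring B] [StarRing B] [Algebra ℂ B] [StarModule ℂ B]

/-- The linear form `ψ ⊗ χ` on the algebraic tensor product. -/
def tensorLin (χ : PositiveFunctional B) : A ⊗[ℂ] B →ₗ[ℂ] ℂ :=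
  LinearMap.mul' ℂ ℂ ∘ₗ TensorProduct.map ψ.toLinearMap χ.toLinearMap

theorem tensorLin_tmul (χ : PositiveFunctional B) (a : A) (b : B) :
    ψ.tensorLin χ (a ⊗ₜ b) = ψ a * χ b := by
  simp [tensorLin]

theorem tensorLin_nonneg (χ : PositiveFunctional B) (c : A ⊗[ℂ] B) :
    0 ≤ ψ.tensorLin χ (c * star c) := by
  obtain ⟨k, a, b, rfl⟩ := TensorProduct.exists_sum_tmul_eq c
  set G : Matrix (Fin k) (Fin k) ℂ := Matrix.of fun i j => χ (b j * star (b i)) with hG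
  have hpos : G.PosSemidef := by
    refine Matrix.PosSemidef.of_dotProduct_mulVec_nonneg ?_ ?_
    · ext i j
      simpa [hG, Matrix.conjTranspose_apply] using χ.star_mul_star (b i) (b j)
    · intro v
      have h := χ.nonneg (∑ i, v i • b i)
      have e : star v ⬝ᵥ (G *ᵥ v) = χ ((∑ i, v i • b i) * star (∑ i, v i • b i)) := by
        simp only [dotProduct, Matrix.mulVec, hG, Matrix.of_apply, star_sum, star_smul,
          Finset.sum_mul, Finset.mul_sum, map_sum, smul_mul_assoc, mul_smul_comm, map_smul,
          smul_eq_mul, Pi.star_apply]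
        rw [Finset.sum_comm]
        conv_lhs => rw [Finset.sum_comm]
        refine Finset.sum_congr rfl fun i _ => Finset.sum_congr rfl fun j _ => ?_
        ring
      rw [e]
      exact h
  obtain ⟨C, hC⟩ : ∃ C : Matrix (Fin k) (Fin k) ℂ, G = Cᴴ * C := by
    open scoped MatrixOrder Matrix.Norms.L2Operator in
    exact CStarAlgebra.nonneg_iff_eq_star_mul_self.mp hpos.nonneg
  have hent : ∀ i j, χ (b j * star (b i)) = ∑ m, star (C m i) * C m j := by
    intro i j
    have := congrFun (congrFun hC i) j
    simpa [hG, Matrix.mul_apply] using this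
  have key : ψ.tensorLin χ ((∑ j, a j ⊗ₜ[ℂ] b j) * star (∑ j, a j ⊗ₜ[ℂ] b j))
      = ∑ m, ψ ((∑ i, C m i • a i) * star (∑ i, C m i • a i)) := by
    have h1 : ψ.tensorLin χ ((∑ j, a j ⊗ₜ[ℂ] b j) * star (∑ j, a j ⊗ₜ[ℂ] b j))
        = ∑ j, ∑ i, ψ (a j * star (a i)) * χ (b j * star (b i)) := by
      simp only [star_sum, TensorProduct.star_tmul, Finset.sum_mul, Finset.mul_sum,
        Algebra.TensorProduct.tmul_mul_tmul, map_sum, tensorLin_tmul]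
      rw [Finset.sum_comm]
    rw [h1]
    simp only [hent, star_sum, star_smul, Finset.sum_mul, Finset.mul_sum, map_sum,
      smul_mul_assoc, mul_smul_comm, map_smul, smul_eq_mul]
    rw [Finset.sum_comm]
    conv_rhs => rw [Finset.sum_comm]
    refine Finset.sum_congr rfl fun i _ => ?_
    rw [Finset.sum_comm]
    refine Finset.sum_congr rfl fun j _ => Finset.sum_congr rfl fun m _ => ?_
    ring
  rw [key]
  exact Finset.sum_nonneg fun m _ => ψ.nonneg _

/-- The positive functional `ψ ⊗ χ` on the algebraic tensor product `A ⊗ B`. -/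
def tensor (χ : PositiveFunctional B) : PositiveFunctional (A ⊗[ℂ] B) where
  toLinearMap := ψ.tensorLin χ
  nonneg' := ψ.tensorLin_nonneg χ

theorem tensor_tmul (χ : PositiveFunctional B) (a : A) (b : B) :
    ψ.tensor χ (a ⊗ₜ b) = ψ a * χ b :=
  ψ.tensorLin_tmul χ a b

end Tensor

/-- The (non-normalised) positive functional `ψ ∘ Tr` on `M_n(A)`. -/
def matrixTrace (n : ℕ) : PositiveFunctional (Matrix (Fin n) (Fin n) A) where
  toLinearMap := ψ.toLinearMap ∘ₗ Matrix.traceLinearMap (Fin n) ℂ A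
  nonneg' a := by
    simp only [LinearMap.comp_apply, Matrix.traceLinearMap_apply, Matrix.trace, Matrix.diag_apply,
      Matrix.mul_apply, Matrix.star_apply, map_sum]
    exact Finset.sum_nonneg fun i _ => Finset.sum_nonneg fun j _ => ψ.nonneg _

theorem matrixTrace_mul_star {n : ℕ} (a b : Matrix (Fin n) (Fin n) A) :
    ψ.matrixTrace n (a * star b) = ∑ i, ∑ j, ψ (a i j * star (b i j)) := by
  change ψ.toLinearMap (Matrix.trace (a * star b)) = _
  simp [Matrix.trace, Matrix.mul_apply, Matrix.star_apply, map_sum]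

end PositiveFunctional

end Functional

/-! ## Noncommutative polynomials and their derivatives -/

section Polynomials

/-- The algebra `ℂ⟨t_1, …, t_n⟩` of noncommutative polynomials. -/
abbrev NCPoly (n : ℕ) : Type := FreeAlgebra ℂ (Fin n)

variable {n : ℕ}

/-- The variable `t_i`. -/
abbrev var (i : Fin n) : NCPoly n := FreeAlgebra.ι ℂ i

/-- The unital homomorphism `P ↦ [[P ⊗ 1, ∂_i P], [0, 1 ⊗ P]]` into the `2 × 2` matrices over
`ℂ⟨t⟩ ⊗ ℂ⟨t⟩`, fixed by its values on the variables; multiplicativity of the upper right entry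
is the Leibniz rule, see `freeDeriv_mul`. -/
def derivHom (i : Fin n) :
    NCPoly n →ₐ[ℂ] Matrix (Fin 2) (Fin 2) (NCPoly n ⊗[ℂ] NCPoly n) :=
  FreeAlgebra.lift ℂ fun j => !![var j ⊗ₜ 1, if i = j then 1 ⊗ₜ 1 else 0; 0, 1 ⊗ₜ var j]

/-- The noncommutative derivative `∂_i : ℂ⟨t⟩ → ℂ⟨t⟩ ⊗ ℂ⟨t⟩`: the derivation with
`∂_i t_j = δ_{ij} 1 ⊗ 1`. -/
def freeDeriv (i : Fin n) : NCPoly n →ₗ[ℂ] NCPoly n ⊗[ℂ] NCPoly n where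
  toFun P := derivHom i P 0 1
  map_add' P Q := by simp
  map_smul' c P := by simp

theorem freeDeriv_var (i j : Fin n) :
    freeDeriv i (var j) = if i = j then 1 ⊗ₜ[ℂ] 1 else 0 := by
  simp [freeDeriv, derivHom]

theorem derivHom_diag (i : Fin n) (P : NCPoly n) :
    derivHom i P 0 0 = P ⊗ₜ 1 ∧ derivHom i P 1 0 = 0 ∧ derivHom i P 1 1 = 1 ⊗ₜ P := by
  induction P using FreeAlgebra.induction with
  | grade0 r =>
    simp [Algebra.algebraMap_eq_smul_one, ← TensorProduct.smul_tmul',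
      Algebra.TensorProduct.one_def]
  | grade1 j => simp [derivHom]
  | mul P Q hP hQ =>
    simp [Matrix.mul_apply, Fin.sum_univ_two, hP.1, hP.2.1, hP.2.2, hQ.1, hQ.2.1, hQ.2.2]
  | add P Q hP hQ =>
    simp [hP.1, hP.2.1, hP.2.2, hQ.1, hQ.2.1, hQ.2.2, TensorProduct.add_tmul,
      TensorProduct.tmul_add]

/-- The Leibniz rule; multiplication by `P ⊗ 1` on the left and by `1 ⊗ Q` on the right is the
bimodule action of `P` and `Q` on `ℂ⟨t⟩ ⊗ ℂ⟨t⟩`. -/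
theorem freeDeriv_mul (i : Fin n) (P Q : NCPoly n) :
    freeDeriv i (P * Q) = freeDeriv i P * (1 ⊗ₜ Q) + (P ⊗ₜ 1) * freeDeriv i Q := by
  simp [freeDeriv, Matrix.mul_apply, Fin.sum_univ_two, (derivHom_diag i P).1,
    (derivHom_diag i Q).2.2, add_comm]

/-- The cyclic derivative `D_i = m ∘ σ ∘ ∂_i`, with `m` the multiplication and `σ` the flip. -/
def cyclicDeriv (i : Fin n) : NCPoly n →ₗ[ℂ] NCPoly n :=
  LinearMap.mul' ℂ (NCPoly n) ∘ₗ
    (TensorProduct.comm ℂ (NCPoly n) (NCPoly n)).toLinearMap ∘ₗ freeDeriv i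

/-- The cyclic gradient `DV = (D_1 V, …, D_n V)`. -/
def cyclicGrad (V : NCPoly n) : Fin n → NCPoly n := fun i => cyclicDeriv i V

/-- The Jacobian matrix, with entry `∂_j P_i` in row `i` and column `j`. -/
def jacobian (P : Fin n → NCPoly n) : Matrix (Fin n) (Fin n) (NCPoly n ⊗[ℂ] NCPoly n) :=
  Matrix.of fun i j => freeDeriv j (P i)

/-- The quadratic potential `½ ∑ t_i²`. -/
def quadraticPotential (n : ℕ) : NCPoly n := (1 / 2 : ℂ) • ∑ i : Fin n, var i ^ 2

theorem cyclicGrad_quadraticPotential (i : Fin n) :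
    cyclicGrad (quadraticPotential n) i = var i := by
  have h : ∀ j : Fin n, cyclicDeriv i (var j ^ 2) = if i = j then (2 : ℂ) • var j else 0 := by
    intro j
    by_cases hij : i = j <;>
      simp [cyclicDeriv, pow_two, freeDeriv_mul, freeDeriv_var, hij, two_smul]
  simp [cyclicGrad, quadraticPotential, h]

end Polynomials

/-! ## Faithful normal states -/

/-- A faithful normal state on a von Neumann algebra. -/
structure FaithfulNormalState (M : Type*) [CStarAlgebra M] [PartialOrder M]
    [StarOrderedRing M] where
  /-- The underlying linear form. -/
  toLinearMap : M →ₗ[ℂ] ℂ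
  nonneg' : ∀ a : M, 0 ≤ a → 0 ≤ toLinearMap a
  map_one' : toLinearMap 1 = 1
  faithful' : ∀ a : M, 0 ≤ a → toLinearMap a = 0 → a = 0
  /-- Normality: suprema of bounded increasing nets of self-adjoint elements are preserved. -/
  normal' : ∀ (s : Set M) (a : M), s.Nonempty → DirectedOn (· ≤ ·) s →
    (∀ x ∈ s, IsSelfAdjoint x) → IsLUB s a → IsLUB (toLinearMap '' s) (toLinearMap a)

section Stein

variable {M : Type*} [CStarAlgebra M] [PartialOrder M] [StarOrderedRing M]

instance : CoeFun (FaithfulNormalState M) (fun _ => M → ℂ) := ⟨fun φ => φ.toLinearMap⟩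

/-- The state as a positive functional on the `*`-algebra `M`. -/
def FaithfulNormalState.functional (φ : FaithfulNormalState M) : PositiveFunctional M where
  toLinearMap := φ.toLinearMap
  nonneg' a := φ.nonneg' _ (mul_star_self_nonneg a)

/-- `φ ⊗ φ^op` on `M ⊗ M^op`. -/
def FaithfulNormalState.tensorOp (φ : FaithfulNormalState M) :
    PositiveFunctional (M ⊗[ℂ] Mᵐᵒᵖ) :=
  φ.functional.tensor φ.functional.op

/-- `(φ ⊗ φ^op) ∘ Tr` on `M_n(M ⊗ M^op)`. -/
def FaithfulNormalState.matrixFunctional (φ : FaithfulNormalState M) (n : ℕ) :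
    PositiveFunctional (Matrix (Fin n) (Fin n) (M ⊗[ℂ] Mᵐᵒᵖ)) :=
  φ.tensorOp.matrixTrace n

/-- The Hilbert space `L²(M_n(M ⊗ M^op), (φ ⊗ φ^op) ∘ Tr)`. It is formed as the completion of
the matrices over the algebraic tensor product; as these are strongly dense in the matrices over
the von Neumann algebra tensor product, this is also the `L²` space of the latter. -/
abbrev SteinL2 (φ : FaithfulNormalState M) (n : ℕ) : Type _ := (φ.matrixFunctional n).L2

variable {n : ℕ}

/-- Evaluation `P ↦ P(X)` of noncommutative polynomials. -/
def eval (X : Fin n → M) : NCPoly n →ₐ[ℂ] M := FreeAlgebra.lift ℂ X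

/-- Evaluation `P ⊗ Q ↦ P(X) ⊗ Q(X)`, with values in `M ⊗ M^op`. -/
def evalTensor (X : Fin n → M) : NCPoly n ⊗[ℂ] NCPoly n →ₗ[ℂ] M ⊗[ℂ] Mᵐᵒᵖ :=
  TensorProduct.map (eval X).toLinearMap
    ((MulOpposite.opLinearEquiv ℂ).toLinearMap ∘ₗ (eval X).toLinearMap)

/-- The evaluated Jacobian matrix `[JP](X)`, as an element of `L²`. -/
def jacobianAt (φ : FaithfulNormalState M) (X : Fin n → M) (P : Fin n → NCPoly n) :
    SteinL2 φ n :=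
  (φ.matrixFunctional n).toL2 ((jacobian P).map (evalTensor X))

/-- The element `(1 ⊗ 1^op) ⊗ I_n` of `L²`. -/
def unitL2 (φ : FaithfulNormalState M) (n : ℕ) : SteinL2 φ n :=
  (φ.matrixFunctional n).toL2 (1 : Matrix (Fin n) (Fin n) (M ⊗[ℂ] Mᵐᵒᵖ))

/-- The inner product `⟨x, y⟩_φ = ∑ φ(x_i y_i^*)` on `M^n`. -/
def tupleInner (φ : FaithfulNormalState M) (x y : Fin n → M) : ℂ :=
  ∑ i, φ (x i * star (y i))

/-- The squared norm of `⟨·, ·⟩_φ` on `M^n`. -/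
def tupleNormSq (φ : FaithfulNormalState M) (x : Fin n → M) : ℝ :=
  (tupleInner φ x x).re

/-- The evaluated cyclic gradient `[DV](X)`. -/
def cyclicGradAt (X : Fin n → M) (V : NCPoly n) : Fin n → M :=
  fun i => eval X (cyclicGrad V i)

/-- `A` is a free Stein kernel for `X` relative to `V`, that is
`⟨[DV](X), P(X)⟩ = ⟨A, [JP](X)⟩` for all `P`. The paired inner products here are linear in the
first variable and `inner` is linear in the second, so that `⟨A, B⟩` is `inner ℂ B A`. -/
def IsFreeSteinKernel (φ : FaithfulNormalState M) (X : Fin n → M) (V : NCPoly n)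
    (A : SteinL2 φ n) : Prop :=
  ∀ P : Fin n → NCPoly n,
    tupleInner φ (cyclicGradAt X V) (fun i => eval X (P i)) = inner ℂ (jacobianAt φ X P) A

/-- The free Stein discrepancy `Σ^*(X|V)`. -/
def steinDiscrepancy (φ : FaithfulNormalState M) (X : Fin n → M) (V : NCPoly n) : ℝ :=
  sInf ((fun A : SteinL2 φ n => ‖A - unitL2 φ n‖) '' {A | IsFreeSteinKernel φ X V A})

/-- The free Poincaré inequality
`‖P(X) - φ(P(X))‖₂² ≤ C ∑_i ‖∂_i P(X)‖₂²` for all noncommutative polynomials `P`. -/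
def SatisfiesFreePoincare (φ : FaithfulNormalState M) (X : Fin n → M) (C : ℝ) : Prop :=
  ∀ P : NCPoly n,
    φ.functional.normSq (eval X P - algebraMap ℂ M (φ (eval X P)))
      ≤ C * ∑ i, φ.tensorOp.normSq (evalTensor X (freeDeriv i P))

/-- The set of nonnegative constants in the free Poincaré inequality. -/
def poincareConstants (φ : FaithfulNormalState M) (X : Fin n → M) : Set ℝ :=
  {C | 0 ≤ C ∧ SatisfiesFreePoincare φ X C}

/-- The best constant `C_opt(X)` in the free Poincaré inequality. -/
def optPoincare (φ : FaithfulNormalState M) (X : Fin n → M) : ℝ :=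
  sInf (poincareConstants φ X)

end Stein

end FreeStein

end

open scoped TensorProduct ComplexOrder Matrix

namespace FreeStein

/-! The kernel comes from Riesz representation. For a centred gradient, Cauchy–Schwarz and the
Poincaré inequality bound the form `P ↦ ⟨P(X), [DV](X)⟩` by `√C ‖[DV](X)‖₂ ‖[JP](X)‖`. It therefore
factors through the evaluated Jacobian and is represented by some `A` with `‖A‖² ≤ C ‖[DV](X)‖₂²`
(`exists_isFreeSteinKernel`). Testing the kernel identity on `P = (t_1, …, t_n)`, whose Jacobian is
the identity, gives `⟨A, 1⟩ = ⟨[DV](X), X⟩`; expanding `‖A - 1‖²` then yields (1). Part (2) is the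
case `[DV](X) = X`.

A finite constant exists because `P ⊗ 1 - 1 ⊗ P` is the sum of the `∂_i P`, each multiplied on the
right by `X_i ⊗ 1 - 1 ⊗ X_i`. Right multiplications are bounded for the norm `ψ(a a^*)`, and no
trace property is needed. -/

/-- A linear form dominated by the norm of a linear map into a Hilbert space is represented by a
vector. -/
theorem exists_inner_eq_of_norm_le {E H : Type*} [AddCommGroup E] [Module ℂ E]
    [NormedAddCommGroup H] [InnerProductSpace ℂ H] [CompleteSpace H]
    (T : E →ₗ[ℂ] H) (f : E →ₗ[ℂ] ℂ) {K : ℝ} (hK : 0 ≤ K) (h : ∀ x, ‖f x‖ ≤ K * ‖T x‖) :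
    ∃ A : H, ‖A‖ ≤ K ∧ ∀ x, inner ℂ A (T x) = f x := by
  -- A linear section `g` of `T` carries `f` to the range of `T`. The choice is immaterial, since
  -- the bound makes `f` vanish on the kernel of `T`.
  obtain ⟨g, hg⟩ := T.rangeRestrict.exists_rightInverse_of_surjective T.range_rangeRestrict
  have hTg : ∀ y, T (g y) = y := fun y => congrArg Subtype.val (LinearMap.congr_fun hg y)
  let F : StrongDual ℂ T.range := (f ∘ₗ g).mkContinuous K fun y => by
    have := h (g y)
    rw [hTg] at this
    exact this
  obtain ⟨G, hG, hnorm⟩ := exists_extension_norm_eq T.range F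
  refine ⟨(InnerProductSpace.toDual ℂ H).symm G, ?_, fun x => ?_⟩
  · rw [LinearIsometryEquiv.norm_map, hnorm]
    exact LinearMap.mkContinuous_norm_le _ hK _
  · rw [InnerProductSpace.toDual_symm_apply]
    have h1 : G (T x) = f (g (T.rangeRestrict x)) := hG (T.rangeRestrict x)
    rw [h1, ← sub_eq_zero, ← map_sub, ← norm_le_zero_iff]
    refine (h _).trans (le_of_eq ?_)
    rw [map_sub, hTg]
    simp

/-! ### Bounded right multiplication on `L²` -/

namespace PositiveFunctional

variable {A : Type*} [Ring A] [StarRing A] [Algebra ℂ A] [StarModule ℂ A]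
  (ψ : PositiveFunctional A)

/-- `toL2` as a linear map. -/
noncomputable def toL2Lin : A →ₗ[ℂ] ψ.L2 where
  toFun := ψ.toL2
  map_add' a b := by simp [toL2, UniformSpace.Completion.coe_add]
  map_smul' c a := by simp [toL2, UniformSpace.Completion.coe_smul]

theorem toL2Lin_apply (a : A) : ψ.toL2Lin a = ψ.toL2 a := rfl

theorem normSq_nonneg (a : A) : 0 ≤ ψ.normSq a := (Complex.le_def.mp (ψ.nonneg a)).1

/-- Right multiplication by `b` is bounded for the `L²` seminorm. -/
def IsRightBounded (b : A) : Prop :=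
  ∃ K : ℝ, ∀ a, ‖ψ.toL2 (a * b)‖ ≤ K * ‖ψ.toL2 a‖

variable {ψ}

theorem IsRightBounded.sub {b c : A} (hb : ψ.IsRightBounded b) (hc : ψ.IsRightBounded c) :
    ψ.IsRightBounded (b - c) := by
  obtain ⟨K, hK⟩ := hb
  obtain ⟨L, hL⟩ := hc
  refine ⟨K + L, fun a => ?_⟩
  rw [mul_sub, ← toL2Lin_apply, map_sub, add_mul]
  exact (norm_sub_le _ _).trans (add_le_add (hK a) (hL a))

/-- If `r² - b b^*` has the form `y y^*`, then right multiplication by `b` is bounded. -/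
theorem isRightBounded_of_add_eq {b y : A} {r : ℝ}
    (h : b * star b + y * star y = algebraMap ℂ A ((r : ℂ) ^ 2)) : ψ.IsRightBounded b := by
  refine ⟨|r|, fun a => abs_le_of_sq_le_sq' ?_ (by positivity) |>.2⟩
  rw [mul_pow, sq_abs, ← normSq_eq_norm_toL2_sq, ← normSq_eq_norm_toL2_sq]
  -- Right multiplication places `b b^*` between `a` and `a^*`, so the identity can be conjugated by
  -- `a`; positivity of the `y` term then gives the bound.
  have h1 : a * b * star (a * b) + a * y * star (a * y) = ((r : ℂ) ^ 2) • (a * star a) := by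
    have : a * b * star (a * b) + a * y * star (a * y)
        = a * (b * star b + y * star y) * star a := by
      simp only [star_mul]; noncomm_ring
    rw [this, h, Algebra.algebraMap_eq_smul_one, mul_smul_comm, mul_one, smul_mul_assoc]
  have h2 := congrArg (fun z => (ψ z).re) h1
  simp only [map_add, map_smul, smul_eq_mul, Complex.add_re] at h2
  rw [← Complex.ofReal_pow, Complex.re_ofReal_mul] at h2
  have h3 := ψ.normSq_nonneg (a * y)
  unfold normSq at h3 ⊢
  linarith

end PositiveFunctional

open PositiveFunctional

/-! ### Evaluated difference quotients -/

section Polynomials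

variable {M : Type*} [CStarAlgebra M] {n : ℕ} (X : Fin n → M)

/-- The opposite product turns the right action of `Q` into a left multiplication. Both Leibniz
terms thus act from the left, leaving the right side free for `X i ⊗ 1 - 1 ⊗ X i`. -/
theorem evalTensor_mul_one_tmul (u : NCPoly n ⊗[ℂ] NCPoly n) (Q : NCPoly n) :
    evalTensor X (u * (1 ⊗ₜ Q)) = (1 ⊗ₜ MulOpposite.op (eval X Q)) * evalTensor X u := by
  induction u with
  | zero => simp
  | tmul a b => simp [evalTensor]
  | add a b ha hb => simp only [add_mul, map_add, mul_add, ha, hb]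

theorem evalTensor_tmul_one_mul (u : NCPoly n ⊗[ℂ] NCPoly n) (P : NCPoly n) :
    evalTensor X ((P ⊗ₜ 1) * u) = (eval X P ⊗ₜ 1) * evalTensor X u := by
  induction u with
  | zero => simp
  | tmul a b => simp [evalTensor]
  | add a b ha hb => simp only [map_add, mul_add, ha, hb]

/-- The free difference quotients recover `P ⊗ 1 - 1 ⊗ P`. -/
theorem sum_evalTensor_freeDeriv_mul (P : NCPoly n) :
    ∑ i, evalTensor X (freeDeriv i P) *
        (X i ⊗ₜ[ℂ] (1 : Mᵐᵒᵖ) - (1 : M) ⊗ₜ[ℂ] MulOpposite.op (X i))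
      = eval X P ⊗ₜ[ℂ] (1 : Mᵐᵒᵖ) - (1 : M) ⊗ₜ[ℂ] MulOpposite.op (eval X P) := by
  induction P using FreeAlgebra.induction with
  | grade0 r =>
    have h : ∀ i : Fin n, freeDeriv i (algebraMap ℂ (NCPoly n) r) = 0 := fun i => by
      simp [freeDeriv, Matrix.algebraMap_matrix_apply]
    simp only [h, map_zero, zero_mul, Finset.sum_const_zero, AlgHom.commutes]
    simp only [Algebra.algebraMap_eq_smul_one, MulOpposite.op_smul, MulOpposite.op_one,
      TensorProduct.smul_tmul, sub_self]
  | grade1 j =>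
    rw [Finset.sum_eq_single j]
    · simp only [freeDeriv_var, if_true]
      rw [evalTensor, TensorProduct.map_tmul]
      simp [eval, ← Algebra.TensorProduct.one_def]
    · intro i _ hij
      rw [freeDeriv_var, if_neg hij]
      simp
    · simp
  | mul P Q hP hQ =>
    -- The Leibniz rule makes the sum telescope: the two copies of `P ⊗ Q` cancel, leaving `PQ ⊗ 1 -
    -- 1 ⊗ PQ`.
    simp only [freeDeriv_mul, map_add, evalTensor_mul_one_tmul, evalTensor_tmul_one_mul, add_mul,
      mul_assoc, Finset.sum_add_distrib, ← Finset.mul_sum, hP, hQ]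
    simp [mul_sub]
  | add P Q hP hQ =>
    simp only [map_add, add_mul, Finset.sum_add_distrib, hP, hQ, TensorProduct.add_tmul,
      TensorProduct.tmul_add, MulOpposite.op_add]
    abel

/-- The evaluated Jacobian, as a linear map into matrices. -/
noncomputable def jacobianEval : (Fin n → NCPoly n) →ₗ[ℂ] Matrix (Fin n) (Fin n) (M ⊗[ℂ] Mᵐᵒᵖ) where
  toFun P := (jacobian P).map (evalTensor X)
  map_add' P Q := by ext i j; simp [jacobian]
  map_smul' c P := by ext i j; simp [jacobian]

theorem jacobianEval_var : jacobianEval X (fun i => var i) = 1 := by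
  ext i j
  by_cases h : i = j
  · subst h
    simp [jacobianEval, jacobian, freeDeriv_var, evalTensor, Algebra.TensorProduct.one_def]
  · have h' : ¬ j = i := fun e => h e.symm
    simp [jacobianEval, jacobian, freeDeriv_var, h, h']

end Polynomials

/-! ### Finiteness of the Poincaré constant -/

section State

variable {M : Type*} [CStarAlgebra M] [PartialOrder M] [StarOrderedRing M]
  (φ : FaithfulNormalState M) {n : ℕ}

theorem FaithfulNormalState.functional_apply (a : M) : φ.functional a = φ a := rfl

theorem FaithfulNormalState.tensorOp_tmul (a b : M) :
    φ.tensorOp (a ⊗ₜ MulOpposite.op b) = φ a * φ b :=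
  tensor_tmul _ _ _ _

theorem FaithfulNormalState.map_star (a : M) : φ (star a) = star (φ a) := by
  simpa [functional_apply] using (φ.functional.star_mul_star a 1).symm

/-- The cross terms are products of `φ q` and its conjugate, so they vanish. What remains is `φ(q
q^*) + φ(q^* q)`, whose second term is dropped. -/
theorem normSq_le_normSq_tmul_sub {q : M} (hq : φ q = 0) :
    φ.functional.normSq q
      ≤ φ.tensorOp.normSq (q ⊗ₜ[ℂ] (1 : Mᵐᵒᵖ) - (1 : M) ⊗ₜ[ℂ] MulOpposite.op q) := by
  have hq' : φ (star q) = 0 := by rw [φ.map_star, hq, star_zero]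
  have h : φ.tensorOp ((q ⊗ₜ[ℂ] (1 : Mᵐᵒᵖ) - (1 : M) ⊗ₜ[ℂ] MulOpposite.op q)
      * star (q ⊗ₜ[ℂ] (1 : Mᵐᵒᵖ) - (1 : M) ⊗ₜ[ℂ] MulOpposite.op q))
      = φ (q * star q) + φ (star q * q) := by
    simp only [star_sub, TensorProduct.star_tmul, star_one, sub_mul, mul_sub,
      Algebra.TensorProduct.tmul_mul_tmul, one_mul, mul_one, map_sub, ← MulOpposite.op_one,
      ← MulOpposite.op_star, ← MulOpposite.op_mul, φ.tensorOp_tmul, hq, hq', φ.map_one']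
    ring
  have h2 := φ.functional.normSq_nonneg (star q)
  simp only [normSq, star_star, φ.functional_apply] at h2 ⊢
  rw [h, Complex.add_re]
  linarith

/-- In a C⋆-algebra, `b b^* + y y^* = ‖b‖²` for some `y`. -/
theorem exists_mul_star_add_eq (b : M) :
    ∃ y : M, b * star b + y * star y = algebraMap ℂ M ((‖b‖ : ℂ) ^ 2) := by
  have h : b * star b ≤ algebraMap ℝ M (‖b‖ ^ 2) := by
    have := (IsSelfAdjoint.mul_star_self b).le_algebraMap_norm_self
    rwa [CStarRing.norm_self_mul_star, ← sq] at this
  obtain ⟨y, hy⟩ := CStarAlgebra.nonneg_iff_eq_mul_star_self.mp (sub_nonneg.mpr h)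
  refine ⟨y, ?_⟩
  rw [← hy, add_sub_cancel, IsScalarTower.algebraMap_apply ℝ ℂ M]
  simp

theorem isRightBounded_tmul_one (b : M) : φ.tensorOp.IsRightBounded (b ⊗ₜ[ℂ] (1 : Mᵐᵒᵖ)) := by
  obtain ⟨y, hy⟩ := exists_mul_star_add_eq b
  refine isRightBounded_of_add_eq (y := y ⊗ₜ[ℂ] (1 : Mᵐᵒᵖ)) (r := ‖b‖) ?_
  simp only [TensorProduct.star_tmul, star_one, Algebra.TensorProduct.tmul_mul_tmul, mul_one,
    ← TensorProduct.add_tmul, hy]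
  rfl

theorem isRightBounded_one_tmul (b : M) :
    φ.tensorOp.IsRightBounded ((1 : M) ⊗ₜ[ℂ] MulOpposite.op b) := by
  -- In the opposite algebra, `op b` times its adjoint is `op (b^* b)`, hence the use of `star b`.
  obtain ⟨y, hy⟩ := exists_mul_star_add_eq (star b)
  rw [star_star] at hy
  refine isRightBounded_of_add_eq (y := (1 : M) ⊗ₜ[ℂ] MulOpposite.op (star y)) (r := ‖star b‖) ?_
  simp only [TensorProduct.star_tmul, star_one, Algebra.TensorProduct.tmul_mul_tmul, mul_one,
    ← MulOpposite.op_star, star_star, ← MulOpposite.op_mul, ← TensorProduct.tmul_add,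
    ← MulOpposite.op_add, hy]
  rw [Algebra.algebraMap_eq_smul_one, Algebra.algebraMap_eq_smul_one, MulOpposite.op_smul,
    TensorProduct.tmul_smul]
  rfl

theorem poincareConstants_nonempty (X : Fin n → M) : (poincareConstants φ X).Nonempty := by
  have hb : ∀ i, φ.tensorOp.IsRightBounded
      (X i ⊗ₜ[ℂ] (1 : Mᵐᵒᵖ) - (1 : M) ⊗ₜ[ℂ] MulOpposite.op (X i)) := fun i =>
    (isRightBounded_tmul_one φ (X i)).sub (isRightBounded_one_tmul φ (X i))
  choose K hK using hb
  -- The constant comes from Cauchy–Schwarz over `i`, applied to the bounds `K i` for right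
  -- multiplication by `X i ⊗ 1 - 1 ⊗ X i`.
  refine ⟨∑ i, K i ^ 2, by positivity, fun P => ?_⟩
  set p := eval X P
  have hq : φ (p - algebraMap ℂ M (φ p)) = 0 := by
    simp [Algebra.algebraMap_eq_smul_one, φ.map_one']
  refine (normSq_le_normSq_tmul_sub φ hq).trans ?_
  -- Scalars cancel in `p ⊗ 1 - 1 ⊗ p`, so centring costs nothing.
  have hpq : (p - algebraMap ℂ M (φ p)) ⊗ₜ[ℂ] (1 : Mᵐᵒᵖ)
      - (1 : M) ⊗ₜ[ℂ] MulOpposite.op (p - algebraMap ℂ M (φ p))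
      = p ⊗ₜ[ℂ] (1 : Mᵐᵒᵖ) - (1 : M) ⊗ₜ[ℂ] MulOpposite.op p := by
    simp only [Algebra.algebraMap_eq_smul_one, MulOpposite.op_sub, MulOpposite.op_smul,
      MulOpposite.op_one, TensorProduct.sub_tmul, TensorProduct.tmul_sub, TensorProduct.smul_tmul]
    abel
  rw [hpq, ← sum_evalTensor_freeDeriv_mul]
  simp only [normSq_eq_norm_toL2_sq]
  refine le_trans ?_ (Finset.sum_mul_sq_le_sq_mul_sq Finset.univ K
    fun i => ‖φ.tensorOp.toL2 (evalTensor X (freeDeriv i P))‖)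
  refine pow_le_pow_left₀ (norm_nonneg _) ?_ 2
  rw [← toL2Lin_apply, map_sum]
  exact (norm_sum_le _ _).trans (Finset.sum_le_sum fun i _ => hK i _)

/-- Each polynomial imposes a closed condition on `C`, so the infimum is attained. -/
theorem isLeast_optPoincare (X : Fin n → M) :
    IsLeast (poincareConstants φ X) (optPoincare φ X) := by
  have hbdd : BddBelow (poincareConstants φ X) := ⟨0, fun C hC => hC.1⟩
  refine IsClosed.isLeast_csInf ?_ (poincareConstants_nonempty φ X) hbdd
  simp only [poincareConstants, SatisfiesFreePoincare, Set.ofPred_and, Set.ofPred_forall]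
  exact isClosed_Ici.inter (isClosed_iInter fun P =>
    isClosed_le continuous_const (continuous_id.mul continuous_const))

/-! ### Construction of the kernel and the discrepancy bound -/

theorem tupleNormSq_eq (x : Fin n → M) : tupleNormSq φ x = ∑ i, φ.functional.normSq (x i) := by
  simp [tupleNormSq, tupleInner, normSq, φ.functional_apply]

theorem tupleNormSq_nonneg (x : Fin n → M) : 0 ≤ tupleNormSq φ x := by
  rw [tupleNormSq_eq]
  exact Finset.sum_nonneg fun i _ => normSq_nonneg _ _

theorem norm_tupleInner_le (x y : Fin n → M) :
    ‖tupleInner φ x y‖ ≤ √(tupleNormSq φ x) * √(tupleNormSq φ y) := by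
  have h := norm_inner_le_norm (𝕜 := ℂ)
    (WithLp.toLp 2 fun i => φ.functional.toL2 (y i)) (WithLp.toLp 2 fun i => φ.functional.toL2 (x i))
  rw [PiLp.inner_apply, PiLp.norm_eq_of_L2, PiLp.norm_eq_of_L2, mul_comm] at h
  simp only [inner_toL2, ← normSq_eq_norm_toL2_sq, ← tupleNormSq_eq] at h
  exact h

theorem tupleInner_star (x y : Fin n → M) : star (tupleInner φ x y) = tupleInner φ y x := by
  rw [tupleInner, star_sum]
  exact Finset.sum_congr rfl fun i _ => φ.functional.star_mul_star _ _

theorem norm_jacobianAt_sq (X : Fin n → M) (P : Fin n → NCPoly n) :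
    ‖jacobianAt φ X P‖ ^ 2 = ∑ i, ∑ j, φ.tensorOp.normSq (evalTensor X (freeDeriv j (P i))) := by
  rw [jacobianAt, ← normSq_eq_norm_toL2_sq, normSq, FaithfulNormalState.matrixFunctional,
    matrixTrace_mul_star]
  simp [normSq, jacobian]

theorem tupleNormSq_sub_le (X : Fin n → M) (P : Fin n → NCPoly n) {C : ℝ}
    (hC : SatisfiesFreePoincare φ X C) :
    tupleNormSq φ (fun i => eval X (P i) - algebraMap ℂ M (φ (eval X (P i))))
      ≤ C * ‖jacobianAt φ X P‖ ^ 2 := by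
  rw [tupleNormSq_eq, norm_jacobianAt_sq, Finset.mul_sum]
  exact Finset.sum_le_sum fun i _ => hC (P i)

/-- A centred tuple pairs with `P(X)` as it does with `P(X) - φ(P(X))`. -/
theorem tupleInner_sub_algebraMap {x : Fin n → M} (hx : ∀ i, φ (x i) = 0) (y : Fin n → M)
    (c : Fin n → ℂ) :
    tupleInner φ x (fun i => y i - algebraMap ℂ M (c i)) = tupleInner φ x y := by
  refine Finset.sum_congr rfl fun i _ => ?_
  simp [Algebra.algebraMap_eq_smul_one, mul_sub, hx]

theorem exists_isFreeSteinKernel (X : Fin n → M) (V : NCPoly n)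
    (hV : ∀ i, φ (cyclicGradAt X V i) = 0) {C : ℝ} (hC0 : 0 ≤ C)
    (hC : SatisfiesFreePoincare φ X C) :
    ∃ A : SteinL2 φ n, IsFreeSteinKernel φ X V A ∧
      ‖A‖ ^ 2 ≤ C * tupleNormSq φ (cyclicGradAt X V) := by
  let T : (Fin n → NCPoly n) →ₗ[ℂ] SteinL2 φ n :=
    (φ.matrixFunctional n).toL2Lin ∘ₗ jacobianEval X
  -- The pairing is conjugate-linear in its second slot, so `P` goes in the first to make `f`
  -- linear; conjugating at the end restores the kernel identity.
  let f : (Fin n → NCPoly n) →ₗ[ℂ] ℂ :=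
    { toFun := fun P => tupleInner φ (fun i => eval X (P i)) (cyclicGradAt X V)
      map_add' := fun P Q => by simp [tupleInner, add_mul, Finset.sum_add_distrib]
      map_smul' := fun c P => by simp [tupleInner, Finset.mul_sum] }
  have hbound : ∀ P, ‖f P‖ ≤ √(C * tupleNormSq φ (cyclicGradAt X V)) * ‖T P‖ := by
    intro P
    change ‖tupleInner φ (fun i => eval X (P i)) (cyclicGradAt X V)‖ ≤ _ * ‖jacobianAt φ X P‖
    rw [← tupleInner_star, norm_star,
      -- The centring of the gradient enters here: `P(X)` may be replaced by `P(X) - φ(P(X))`, which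
      -- the Poincaré inequality controls.
      ← tupleInner_sub_algebraMap φ hV _ fun i => φ (eval X (P i))]
    refine (norm_tupleInner_le φ _ _).trans ?_
    rw [Real.sqrt_mul hC0, mul_comm √C, mul_assoc]
    refine mul_le_mul_of_nonneg_left ?_ (Real.sqrt_nonneg _)
    refine (Real.sqrt_le_sqrt (tupleNormSq_sub_le φ X P hC)).trans (le_of_eq ?_)
    rw [Real.sqrt_mul hC0, Real.sqrt_sq (norm_nonneg _)]
  obtain ⟨A, hA, hAT⟩ := exists_inner_eq_of_norm_le T f (Real.sqrt_nonneg _) hbound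
  refine ⟨A, fun P => ?_, ?_⟩
  · rw [← tupleInner_star, ← inner_conj_symm]
    exact congrArg star (hAT P).symm
  · have := pow_le_pow_left₀ (norm_nonneg _) hA 2
    rwa [Real.sq_sqrt (mul_nonneg hC0 (tupleNormSq_nonneg φ _))] at this

theorem norm_unitL2_sq : ‖unitL2 φ n‖ ^ 2 = n := by
  have h1 : φ.tensorOp 1 = 1 := by
    rw [Algebra.TensorProduct.one_def, ← MulOpposite.op_one, φ.tensorOp_tmul, φ.map_one', one_mul]
  rw [unitL2, ← normSq_eq_norm_toL2_sq, normSq, FaithfulNormalState.matrixFunctional,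
    matrixTrace_mul_star]
  have h2 : ∀ i j : Fin n, φ.tensorOp ((1 : Matrix (Fin n) (Fin n) (M ⊗[ℂ] Mᵐᵒᵖ)) i j
      * star ((1 : Matrix (Fin n) (Fin n) (M ⊗[ℂ] Mᵐᵒᵖ)) i j)) = if i = j then 1 else 0 := by
    intro i j
    by_cases h : i = j
    · subst h; simp [h1]
    · simp [h]
  change (∑ i, ∑ j, φ.tensorOp _).re = _
  simp [h2]

/-- The cross term is the same for every kernel: it is the kernel identity tested on the variables,
whose Jacobian is the identity matrix. -/
theorem norm_sub_unitL2_sq (X : Fin n → M) {V : NCPoly n} {A : SteinL2 φ n}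
    (hA : IsFreeSteinKernel φ X V A) :
    ‖A - unitL2 φ n‖ ^ 2 = n + ‖A‖ ^ 2 - 2 * (tupleInner φ (cyclicGradAt X V) X).re := by
  have h1 : tupleInner φ (cyclicGradAt X V) X = inner ℂ (unitL2 φ n) A := by
    have h := hA fun i => var i
    have hJ : jacobianAt φ X (fun i => var i) = unitL2 φ n :=
      congrArg (φ.matrixFunctional n).toL2 (jacobianEval_var X)
    simpa [hJ, eval] using h
  rw [norm_sub_sq (𝕜 := ℂ), norm_unitL2_sq, h1, ← inner_conj_symm]
  simp only [RCLike.re_eq_complex_re, Complex.conj_re]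
  ring

theorem steinDiscrepancy_sq_le (X : Fin n → M) {V : NCPoly n} {A : SteinL2 φ n}
    (hA : IsFreeSteinKernel φ X V A) :
    steinDiscrepancy φ X V ^ 2 ≤ ‖A - unitL2 φ n‖ ^ 2 := by
  have h0 : ∀ r ∈ (fun A : SteinL2 φ n => ‖A - unitL2 φ n‖) '' {A | IsFreeSteinKernel φ X V A},
      0 ≤ r := by
    rintro _ ⟨B, -, rfl⟩
    exact norm_nonneg _
  exact pow_le_pow_left₀ (Real.sInf_nonneg h0) (csInf_le ⟨0, h0⟩ ⟨A, hA, rfl⟩) 2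

theorem exists_isFreeSteinKernel_bound (X : Fin n → M) (V : NCPoly n)
    (hV : ∀ i, φ (cyclicGradAt X V i) = 0) :
    ∃ A : SteinL2 φ n, IsFreeSteinKernel φ X V A ∧
      steinDiscrepancy φ X V ^ 2 ≤ ‖A - unitL2 φ n‖ ^ 2 ∧
      ‖A - unitL2 φ n‖ ^ 2 ≤
        n + optPoincare φ X * tupleNormSq φ (cyclicGradAt X V)
          - 2 * (tupleInner φ (cyclicGradAt X V) X).re := by
  obtain ⟨hC0, hC⟩ := (isLeast_optPoincare φ X).1
  obtain ⟨A, hA, hle⟩ := exists_isFreeSteinKernel φ X V hV hC0 hC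
  refine ⟨A, hA, steinDiscrepancy_sq_le φ X hA, ?_⟩
  rw [norm_sub_unitL2_sq φ X hA]
  linarith

end State

end FreeStein

theorem mainTheorem3 {M : Type*} [CStarAlgebra M] [WStarAlgebra M] [PartialOrder M]
    [StarOrderedRing M] (φ : FreeStein.FaithfulNormalState M) {n : ℕ} (X : Fin n → M)
    (hX : ∀ i, IsSelfAdjoint (X i)) :
    -- the best Poincaré constant is finite and attained, so that the bounds below are meaningful
    IsLeast (FreeStein.poincareConstants φ X) (FreeStein.optPoincare φ X) ∧
    (∀ V : FreeStein.NCPoly n, (∀ i, φ (FreeStein.cyclicGradAt X V i) = 0) →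
      ∃ A : FreeStein.SteinL2 φ n,
        FreeStein.IsFreeSteinKernel φ X V A ∧
        FreeStein.steinDiscrepancy φ X V ^ 2 ≤ ‖A - FreeStein.unitL2 φ n‖ ^ 2 ∧
        ‖A - FreeStein.unitL2 φ n‖ ^ 2 ≤
          n + FreeStein.optPoincare φ X * FreeStein.tupleNormSq φ (FreeStein.cyclicGradAt X V)
            - 2 * (FreeStein.tupleInner φ (FreeStein.cyclicGradAt X V) X).re) ∧
    ((∀ i, φ (X i) = 0) → ∑ i, φ (X i ^ 2) = n →
      FreeStein.steinDiscrepancy φ X (FreeStein.quadraticPotential n) ^ 2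
        ≤ n * (FreeStein.optPoincare φ X - 1)) := by
  refine ⟨FreeStein.isLeast_optPoincare φ X,
    FreeStein.exists_isFreeSteinKernel_bound φ X, fun h0 hn => ?_⟩
  have hgrad : FreeStein.cyclicGradAt X (FreeStein.quadraticPotential n) = X := by
    funext i
    simp [FreeStein.cyclicGradAt, FreeStein.cyclicGrad_quadraticPotential, FreeStein.eval]
  have hinner : FreeStein.tupleInner φ X X = n := by
    rw [← hn]
    refine Finset.sum_congr rfl fun i _ => ?_
    rw [(hX i).star_eq, sq]
  obtain ⟨A, -, h1, h2⟩ := FreeStein.exists_isFreeSteinKernel_bound φ X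
    (FreeStein.quadraticPotential n) (by rw [hgrad]; exact h0)
  -- Both `‖X‖₂²` and `⟨X, X⟩` equal `n`, so the bound reads `n + C n - 2 n`.
  rw [hgrad, FreeStein.tupleNormSq, hinner, Complex.natCast_re] at h2
  linarith
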